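/- Let $k\ge 3$ be an integer. For a Dirichlet character $\chi$ modulo $k$ let $L(4,\chi)=\sum_{n=1}^{\infty}\chi(n)n^{-4}$, and call $\chi$ even if $\chi(-1)=1$. Let $\phi$ be the Euler totient function and, for $s\ge 1$, let $J_s(k)=k^s\prod_{p\mid k,\ p\text{ prime}}\left(1-p^{-s}\right)$ be the Jordan totient function. Then $$\sum_{\substack{\chi \bmod k\\ \chi\text{ even}}}|L(4,\chi)|^2=\frac{\pi^8}{27k^8}\,\phi(k)\left(\frac{J_8(k)}{700}+\frac{J_4(k)}{150}+\frac{2}{21}J_2(k)\right),$$ where the sum is over all even Dirichlet characters modulo $k$, including the principal one. -/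

import Mathlib

/-- The Jordan totient function `J_s(n) = n ^ s * ∏_{p ∣ n, p prime} (1 - 1 / p ^ s)`, as a real
number. -/
noncomputable def jordanTotient (s n : ℕ) : ℝ :=
  (n : ℝ) ^ s * ∏ p ∈ n.primeFactors, (1 - 1 / (p : ℝ) ^ s)

open scoped Classical in
/-- The set of even Dirichlet characters modulo `k`, that is, those with `χ (-1) = 1`. -/
noncomputable def evenCharacters (k : ℕ) [NeZero k] : Finset (DirichletCharacter ℂ k) :=
  Finset.univ.filter fun χ => χ.Even

open Finset Complex

/-! Summing `χ n / n ^ 4` over all nonzero integers gives `(1 + χ (-1)) L(4, χ)`, which is `2 L(4,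
χ)` for even `χ` and `0` for odd `χ`. Grouping by residues, it is also a character sum of
`latticeQuartic`, so orthogonality turns the mean square into a sum of `latticeQuartic (a / k) ^ 2`
over `a` coprime to `k`. Möbius inversion reduces this to complete sums modulo divisors `n` of `k`.
There Parseval for additive characters replaces `latticeQuartic` by `B₄`, whose squares sum to an
explicit polynomial in `n`. Its powers of `n` become Jordan totients. -/

/-- If the functions `e · a`, `a ∈ s`, are pairwise orthogonal of square norm `K`, then a real linear
combination of them has square norm `K` times the sum of the squares of the coefficients. -/
lemma sum_norm_sq_of_orthogonal {ι α : Type*} [Fintype ι] [DecidableEq α] (s : Finset α)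
    (h : α → ℝ) (e : ι → α → ℂ) (K : ℝ)
    (orth : ∀ a ∈ s, ∀ b ∈ s,
      ∑ i, (starRingEnd ℂ) (e i a) * e i b = if a = b then (K : ℂ) else 0) :
    ∑ i, ‖∑ a ∈ s, e i a * (h a : ℂ)‖ ^ 2 = K * ∑ a ∈ s, h a ^ 2 := by
  apply Complex.ofReal_injective
  push_cast
  calc ∑ i, ((‖∑ a ∈ s, e i a * (h a : ℂ)‖ : ℝ) : ℂ) ^ 2
      = ∑ i, ∑ a ∈ s, ∑ b ∈ s, (h a * h b : ℂ) * ((starRingEnd ℂ) (e i a) * e i b) := by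
        refine sum_congr rfl fun i _ => ?_
        rw [← Complex.conj_mul', map_sum, sum_mul_sum]
        refine sum_congr rfl fun a _ => sum_congr rfl fun b _ => ?_
        rw [map_mul, Complex.conj_ofReal]
        ring
    _ = ∑ a ∈ s, ∑ b ∈ s, (h a * h b : ℂ) * ∑ i, (starRingEnd ℂ) (e i a) * e i b := by
        rw [sum_comm]
        refine sum_congr rfl fun a _ => ?_
        rw [sum_comm]
        simp only [mul_sum]
    _ = K * ∑ a ∈ s, (h a : ℂ) ^ 2 := by
        rw [mul_sum]
        refine sum_congr rfl fun a ha => ?_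
        rw [sum_congr rfl fun b hb => by rw [orth a ha b hb]]
        simp only [mul_ite, mul_zero, sum_ite_eq, ha, if_true]
        ring

/-- The sum of `(x + m)⁻⁴` over all integers `m` with `x + m ≠ 0`. -/
noncomputable def latticeQuartic (x : ℝ) : ℝ := ∑' m : ℤ, 1 / (x + m) ^ 4

lemma hasSum_residueClass (k : ℕ) [NeZero k] (a : ZMod k) :
    HasSum (fun n : ℤ => if (n : ZMod k) = a then 1 / (n : ℝ) ^ 4 else 0)
      (latticeQuartic (a.val / k) / (k : ℝ) ^ 4) := by
  have hk : (k : ℝ) ≠ 0 := Nat.cast_ne_zero.mpr (NeZero.ne k)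
  have hinj : Function.Injective fun m : ℤ => (a.val : ℤ) + m * k := by
    intro m m' h
    simpa [NeZero.ne k] using h
  have hrange : ∀ n ∉ Set.range (fun m : ℤ => (a.val : ℤ) + m * k),
      (if (n : ZMod k) = a then 1 / (n : ℝ) ^ 4 else 0) = 0 := by
    intro n hn
    refine if_neg fun h => hn ?_
    have h' : ((a.val : ℤ) : ZMod k) = n := by simp [h]
    obtain ⟨m, hm⟩ := (ZMod.intCast_eq_intCast_iff_dvd_sub _ _ _).mp h'
    exact ⟨m, by simp only; linarith [mul_comm (k : ℤ) m]⟩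
  -- The convention `1 / 0 = 0` removes `n = 0` on both sides when `a = 0`.
  rw [← hinj.hasSum_iff hrange]
  have hs : Summable fun m : ℤ => 1 / (((a.val : ℤ) + m * k : ℤ) : ℝ) ^ 4 :=
    (Real.summable_one_div_int_pow.mpr (by norm_num : 1 < 4)).comp_injective hinj
  have hterm : ∀ m : ℤ, 1 / (((a.val : ℤ) + m * k : ℤ) : ℝ) ^ 4
      = 1 / ((a.val : ℝ) / k + m) ^ 4 / (k : ℝ) ^ 4 := by
    intro m
    rw [div_div, ← mul_pow, add_mul, div_mul_cancel₀ _ hk]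
    push_cast
    rfl
  have hval : latticeQuartic (a.val / k) / (k : ℝ) ^ 4
      = ∑' m : ℤ, 1 / (((a.val : ℤ) + m * k : ℤ) : ℝ) ^ 4 := by
    simp only [hterm]
    rw [tsum_div_const, latticeQuartic]
  rw [hval]
  refine hs.hasSum.congr_fun fun m => ?_
  simp

lemma hasSum_periodic (k : ℕ) [NeZero k] (Φ : ZMod k → ℂ) :
    HasSum (fun n : ℤ => Φ n * (1 / (n : ℂ) ^ 4))
      (∑ a, Φ a * ((latticeQuartic (a.val / k) / (k : ℝ) ^ 4 : ℝ) : ℂ)) := by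
  have := hasSum_sum (s := Finset.univ) fun a _ =>
    (Complex.hasSum_ofReal.mpr (hasSum_residueClass k a)).mul_left (Φ a)
  refine this.congr_fun fun n => ?_
  rw [sum_eq_single_of_mem (n : ZMod k) (mem_univ _) fun a _ ha => by simp [ha.symm]]
  simp

/-- Both sides evaluate the Fourier series of `B₄` at `j / k`; the constant is `-(2πi)⁴ / 4!`. -/
lemma sum_stdAddChar_mul_latticeQuartic (k : ℕ) [NeZero k] (j : ZMod k) :
    ∑ a, ZMod.stdAddChar (j * a) * ((latticeQuartic (a.val / k) / (k : ℝ) ^ 4 : ℝ) : ℂ)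
      = ((-(2 / 3 * Real.pi ^ 4 * bernoulliFun 4 (j.val / k)) : ℝ) : ℂ) := by
  have hk : (0 : ℝ) < k := Nat.cast_pos.mpr (NeZero.pos k)
  have hj : (j.val / k : ℝ) ∈ Set.Icc (0 : ℝ) 1 :=
    ⟨by positivity, (div_le_one hk).mpr (by exact_mod_cast j.val_lt.le)⟩
  have h2 := hasSum_one_div_pow_mul_fourier_mul_bernoulliFun (k := 4) (by norm_num) hj
  have h1 := hasSum_periodic k fun a => ZMod.stdAddChar (j * a)
  refine (h1.unique (h2.congr_fun fun n => ?_)).trans ?_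
  · have : j * (n : ZMod k) = ((j.val * n : ℤ) : ZMod k) := by simp
    rw [this, ZMod.stdAddChar_coe, fourier_coe_apply, mul_comm]
    congr 2
    push_cast
    ring
  · push_cast [Nat.factorial]
    rw [mul_pow, mul_pow, Complex.I_pow_four]
    ring

lemma bernoulliFun_four (x : ℝ) : bernoulliFun 4 x = x ^ 4 - 2 * x ^ 3 + x ^ 2 - 1 / 30 := by
  simp [bernoulliFun, Polynomial.bernoulli_def, sum_range_succ, bernoulli_eq_bernoulli'_of_ne_one,
    Nat.choose]
  ring

lemma sum_range_bernoulliFun_four_sq (n : ℕ) (hn : n ≠ 0) :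
    (n : ℝ) ^ 7 * ∑ j ∈ range n, bernoulliFun 4 (j / n) ^ 2
      = 1 / 3 * ((n : ℝ) ^ 8 / 700 + (n : ℝ) ^ 4 / 150 + 2 / 21 * (n : ℝ) ^ 2 - 1 / 10) := by
  -- The denominator `n`, cleared into `c`, stays fixed while induction moves the length `N`.
  have key : ∀ N : ℕ, ∀ c : ℝ,
      ∑ j ∈ range N, ((j : ℝ) ^ 4 - 2 * (j : ℝ) ^ 3 * c + (j : ℝ) ^ 2 * c ^ 2 - c ^ 4 / 30) ^ 2
      = (N : ℝ) ^ 9 / 9 - N ^ 8 / 2 + 2 * N ^ 7 / 3 - 7 * N ^ 5 / 15 + 2 * N ^ 3 / 9 - N / 30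
        + (-N ^ 8 / 2 + 2 * N ^ 7 - 7 * N ^ 6 / 3 + 7 * N ^ 4 / 6 - N ^ 2 / 3) * c
        + (6 * N ^ 7 / 7 - 3 * N ^ 6 + 3 * N ^ 5 - N ^ 3 + N / 7) * c ^ 2
        + (-2 * N ^ 6 / 3 + 2 * N ^ 5 - 5 * N ^ 4 / 3 + N ^ 2 / 3) * c ^ 3
        + (14 * N ^ 5 / 75 - 7 * N ^ 4 / 15 + 14 * N ^ 3 / 45 - 7 * N / 225) * c ^ 4
        + (N ^ 4 / 30 - N ^ 3 / 15 + N ^ 2 / 30) * c ^ 5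
        + (-N ^ 3 / 45 + N ^ 2 / 30 - N / 90) * c ^ 6 + N / 900 * c ^ 8 := by
    intro N c
    induction N with
    | zero => simp
    | succ N ih =>
      rw [sum_range_succ, ih]
      push_cast
      ring
  have hn' : (n : ℝ) ≠ 0 := Nat.cast_ne_zero.mpr hn
  have hterm : ∀ j : ℕ, bernoulliFun 4 (j / n) ^ 2
      = ((j : ℝ) ^ 4 - 2 * (j : ℝ) ^ 3 * n + (j : ℝ) ^ 2 * (n : ℝ) ^ 2 - (n : ℝ) ^ 4 / 30) ^ 2
        / (n : ℝ) ^ 8 := by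
    intro j
    rw [bernoulliFun_four]
    field_simp
  simp only [hterm]
  rw [← sum_div, key]
  field_simp
  ring

lemma sum_zmod_eq_sum_range (k : ℕ) [NeZero k] (f : ℕ → ℝ) :
    ∑ a : ZMod k, f a.val = ∑ a ∈ range k, f a := by
  refine sum_bij (fun a _ => a.val) (fun a _ => mem_range.mpr a.val_lt)
    (fun a _ b _ h => ZMod.val_injective k h)
    (fun b hb => ⟨b, mem_univ _, ZMod.val_natCast_of_lt (mem_range.mp hb)⟩) fun _ _ => rfl

/-- Parseval on `ZMod n`, with the `B₄` values as Fourier transform. -/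
lemma sum_range_latticeQuartic_sq (n : ℕ) (hn : n ≠ 0) :
    ∑ a ∈ range n, latticeQuartic (a / n) ^ 2 = 4 / 27 * Real.pi ^ 8 *
      ((n : ℝ) ^ 8 / 700 + (n : ℝ) ^ 4 / 150 + 2 / 21 * (n : ℝ) ^ 2 - 1 / 10) := by
  have : NeZero n := ⟨hn⟩
  have hn' : (n : ℝ) ≠ 0 := Nat.cast_ne_zero.mpr hn
  have h := sum_norm_sq_of_orthogonal (Finset.univ : Finset (ZMod n))
    (fun a => latticeQuartic (a.val / n) / (n : ℝ) ^ 4)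
    (fun j a => ZMod.stdAddChar (j * a)) n (by
      intro a _ b _
      have := AddChar.sum_mulShift (b - a) (ZMod.isPrimitive_stdAddChar n)
      simp only [sub_eq_zero, ZMod.card] at this
      simp only [eq_comm (a := a)]
      push_cast at this ⊢
      rw [← this]
      refine sum_congr rfl fun j _ => ?_
      rw [← AddChar.map_neg_eq_conj, ← AddChar.map_add_eq_mul]
      congr 1
      ring)
  simp only [sum_stdAddChar_mul_latticeQuartic, Complex.norm_real, Real.norm_eq_abs, sq_abs] at h
  rw [sum_zmod_eq_sum_range n fun j => (-(2 / 3 * Real.pi ^ 4 * bernoulliFun 4 (j / n))) ^ 2,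
    sum_zmod_eq_sum_range n fun j => (latticeQuartic (j / n) / (n : ℝ) ^ 4) ^ 2] at h
  simp only [neg_sq, mul_pow, div_pow, ← mul_sum, ← sum_div] at h
  have hB := sum_range_bernoulliFun_four_sq n hn
  calc ∑ a ∈ range n, latticeQuartic (a / n) ^ 2
      = (n : ℝ) ^ 7 * (n * ((∑ a ∈ range n, latticeQuartic (a / n) ^ 2) / ((n : ℝ) ^ 4) ^ 2)) := by
        field_simp
    _ = _ := by
        rw [← h]
        linear_combination 4 / 9 * Real.pi ^ 8 * hB

-- Coprimality is detected by summing `μ d` over `d ∣ gcd(a, k)`; writing `a = d * b` gives `a / k =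
-- b / (k / d)`.
open ArithmeticFunction in
lemma sum_coprime_eq_sum_moebius (k : ℕ) (hk : k ≠ 0) (F : ℝ → ℝ) :
    ∑ a ∈ range k with a.Coprime k, F (a / k)
      = ∑ d ∈ k.divisors, (moebius d : ℝ) * ∑ b ∈ range (k / d), F (b / (k / d : ℕ)) := by
  have h1 : ∀ d ∈ k.divisors, ∑ b ∈ range (k / d), F (b / (k / d : ℕ))
      = ∑ a ∈ range k, if d ∣ a then F (a / k) else 0 := by
    intro d hd
    obtain ⟨e, rfl⟩ := Nat.dvd_of_mem_divisors hd
    have hd0 : d ≠ 0 := left_ne_zero_of_mul hk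
    rw [Nat.mul_div_cancel_left _ (Nat.pos_of_ne_zero hd0), ← sum_filter]
    refine sum_bij (fun b _ => d * b) ?_ ?_ ?_ ?_
    · intro b hb
      simp only [mem_filter, mem_range] at hb ⊢
      exact ⟨Nat.mul_lt_mul_of_pos_left hb (Nat.pos_of_ne_zero hd0), dvd_mul_right _ _⟩
    · intro b _ c _ h
      exact Nat.eq_of_mul_eq_mul_left (Nat.pos_of_ne_zero hd0) h
    · intro a ha
      simp only [mem_filter, mem_range] at ha
      obtain ⟨ha, b, rfl⟩ := ha
      exact ⟨b, mem_range.mpr (Nat.lt_of_mul_lt_mul_left ha), rfl⟩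
    · intro b _
      push_cast
      rw [mul_div_mul_left _ _ (Nat.cast_ne_zero.mpr hd0)]
  simp +contextual only [h1, mul_sum]
  rw [sum_comm, sum_filter]
  refine sum_congr rfl fun a _ => ?_
  have h2 : ∑ d ∈ k.divisors with d ∣ a, moebius d = if a.gcd k = 1 then 1 else 0 := by
    have : k.divisors.filter (· ∣ a) = (a.gcd k).divisors := by
      ext d
      simp [Nat.dvd_gcd_iff, hk, and_comm]
    rw [this, ← coe_mul_zeta_apply, moebius_mul_coe_zeta, one_apply]
  simp only [mul_ite, mul_zero]
  rw [← sum_filter, ← sum_mul, ← Int.cast_sum, h2]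
  simp [Nat.Coprime]

open ArithmeticFunction in
lemma prod_primeFactors_one_sub_eq_sum_moebius (n s : ℕ) (hn : n ≠ 0) :
    ∏ p ∈ n.primeFactors, (1 - 1 / (p : ℝ) ^ s)
      = ∑ d ∈ n.divisors, (moebius d : ℝ) * (1 / (d : ℝ) ^ s) := by
  -- The value at `0` is forced, since `1 / 0 ^ s` is `1` when `s = 0`.
  let f : ArithmeticFunction ℝ := ⟨fun d => if d = 0 then 0 else 1 / (d : ℝ) ^ s, by simp⟩
  have hf0 : ∀ d, d ≠ 0 → f d = 1 / (d : ℝ) ^ s := fun d hd => if_neg hd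
  have hf : f.IsMultiplicative := by
    refine IsMultiplicative.iff_ne_zero.mpr ⟨by simp [hf0], fun {a b} ha hb _ => ?_⟩
    rw [hf0 _ (mul_ne_zero ha hb), hf0 _ ha, hf0 _ hb]
    push_cast
    rw [mul_pow, one_div_mul_one_div]
  have hprime : ∀ p ∈ n.primeFactors, p.Prime := fun p hp => Nat.prime_of_mem_primeFactors hp
  -- The product expands over divisors of the radical; `μ` kills the other divisors of `n`.
  have hsq : Squarefree (∏ p ∈ n.primeFactors, p) :=
    by
    refine squarefree_prod_of_pairwise_isCoprime (fun p hp q hq hpq => ?_)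
      fun p hp => (hprime p hp).squarefree
    exact Nat.coprime_iff_isRelPrime.mp ((Nat.coprime_primes (hprime p hp) (hprime q hq)).mpr hpq)
  have hdvd : (∏ p ∈ n.primeFactors, p) ∣ n := Nat.prod_primeFactors_dvd n
  have h := hf.prodPrimeFactors_one_sub_of_squarefree f hsq
  rw [Nat.primeFactors_prod hprime] at h
  calc ∏ p ∈ n.primeFactors, (1 - 1 / (p : ℝ) ^ s)
      = ∏ p ∈ n.primeFactors, (1 - f p) :=
        prod_congr rfl fun p hp => by rw [hf0 p (hprime p hp).ne_zero]
    _ = ∑ d ∈ (∏ p ∈ n.primeFactors, p).divisors, (moebius d : ℝ) * (1 / (d : ℝ) ^ s) := by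
        rw [h]
        exact sum_congr rfl fun d hd => by rw [hf0 d (Nat.pos_of_mem_divisors hd).ne']
    _ = ∑ d ∈ n.divisors, (moebius d : ℝ) * (1 / (d : ℝ) ^ s) := by
        refine sum_subset (Nat.divisors_subset_of_dvd hn hdvd) fun d hd hd' => ?_
        rw [moebius_eq_zero_of_not_squarefree, Int.cast_zero, zero_mul]
        refine fun hds => hd' (Nat.mem_divisors.mpr ⟨?_, hsq.ne_zero⟩)
        rw [← Nat.prod_primeFactors_of_squarefree hds]
        exact prod_dvd_prod_of_subset _ _ _
          (Nat.primeFactors_mono (Nat.dvd_of_mem_divisors hd) hn)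

open ArithmeticFunction in
lemma jordanTotient_eq_sum_moebius (n s : ℕ) (hn : n ≠ 0) :
    jordanTotient s n = ∑ d ∈ n.divisors, (moebius d : ℝ) * ((n / d : ℕ) : ℝ) ^ s := by
  rw [jordanTotient, prod_primeFactors_one_sub_eq_sum_moebius n s hn, mul_sum]
  refine sum_congr rfl fun d hd => ?_
  have hd0 : (d : ℝ) ≠ 0 := Nat.cast_ne_zero.mpr (Nat.pos_of_mem_divisors hd).ne'
  rw [Nat.cast_div (Nat.dvd_of_mem_divisors hd) hd0, div_pow]
  ring

open ArithmeticFunction in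
lemma sum_coprime_latticeQuartic_sq (k : ℕ) (hk : 2 ≤ k) :
    ∑ a ∈ range k with a.Coprime k, latticeQuartic (a / k) ^ 2 = 4 / 27 * Real.pi ^ 8 *
      (jordanTotient 8 k / 700 + jordanTotient 4 k / 150 + 2 / 21 * jordanTotient 2 k) := by
  have hk0 : k ≠ 0 := by omega
  -- This cancels the constant `-1 / 10`, and needs `k ≠ 1`.
  have hmu : ∑ d ∈ k.divisors, (moebius d : ℝ) = 0 := by
    rw [← Int.cast_sum, ← coe_mul_zeta_apply, moebius_mul_coe_zeta, one_apply_ne (by omega),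
      Int.cast_zero]
  rw [sum_coprime_eq_sum_moebius k hk0 fun x => latticeQuartic x ^ 2]
  simp only [jordanTotient_eq_sum_moebius k _ hk0]
  have h : ∀ d ∈ k.divisors,
      (moebius d : ℝ) * ∑ b ∈ range (k / d), latticeQuartic (b / (k / d : ℕ)) ^ 2
      = 4 / 27 * Real.pi ^ 8 * ((moebius d : ℝ) * ((k / d : ℕ) : ℝ) ^ 8 / 700
        + (moebius d : ℝ) * ((k / d : ℕ) : ℝ) ^ 4 / 150
        + 2 / 21 * ((moebius d : ℝ) * ((k / d : ℕ) : ℝ) ^ 2) - 1 / 10 * (moebius d : ℝ)) := by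
    intro d hd
    rw [sum_range_latticeQuartic_sq _ (Nat.div_pos (Nat.divisor_le hd)
      (Nat.pos_of_mem_divisors hd)).ne']
    ring
  rw [sum_congr rfl h, ← mul_sum, sum_sub_distrib, sum_add_distrib, sum_add_distrib, ← mul_sum,
    ← mul_sum, hmu, sum_div, sum_div]
  ring

lemma sum_dirichletCharacter_mul_latticeQuartic (k : ℕ) [NeZero k] (hk : 2 ≤ k)
    (χ : DirichletCharacter ℂ k) :
    ∑ a, χ a * ((latticeQuartic (a.val / k) / (k : ℝ) ^ 4 : ℝ) : ℂ)
      = (1 + χ (-1)) * LSeries (fun n : ℕ => χ (n : ZMod k)) 4 := by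
  have : Fact (1 < k) := ⟨hk⟩
  have h := (hasSum_periodic k χ).nat_add_neg
  have h0 : χ ((0 : ℤ) : ZMod k) * (1 / ((0 : ℤ) : ℂ) ^ 4) = 0 := by simp
  rw [h0, add_zero] at h
  rw [← h.tsum_eq, LSeries, ← tsum_mul_left]
  refine tsum_congr fun n => ?_
  have hneg : χ (-(n : ZMod k)) = χ (-1) * χ n := by rw [← map_mul, neg_one_mul]
  -- As `1 < k`, `0` is not a unit, so `χ 0 = 0`.
  rw [LSeries.term_def₀ (by simpa using χ.map_nonunit not_isUnit_zero)]
  push_cast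
  rw [hneg, Complex.cpow_neg, Complex.cpow_ofNat]
  ring

open scoped Classical in
lemma sum_norm_sq_dirichletCharacter (k : ℕ) [NeZero k] (h : ZMod k → ℝ) :
    ∑ χ : DirichletCharacter ℂ k, ‖∑ a, χ a * (h a : ℂ)‖ ^ 2
      = k.totient * ∑ a with IsUnit a, h a ^ 2 := by
  rw [← sum_norm_sq_of_orthogonal (ι := DirichletCharacter ℂ k) {a : ZMod k | IsUnit a} h
    (fun χ a => χ a) k.totient]
  · refine sum_congr rfl fun χ _ => ?_
    rw [sum_filter_of_ne]
    intro a _ ha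
    by_contra hu
    exact ha (by rw [χ.map_nonunit hu, zero_mul])
  · intro a ha b _
    have hu : IsUnit a := by simpa using ha
    have := DirichletCharacter.sum_char_inv_mul_char_eq ℂ hu b
    push_cast
    rw [← this]
    refine sum_congr rfl fun χ _ => ?_
    rw [starRingEnd_apply, MulChar.star_apply', MulChar.inv_apply]
    obtain ⟨u, rfl⟩ := hu
    rw [Ring.inverse_unit, ZMod.inv_coe_unit]

theorem theorem2 (k : ℕ) [NeZero k] (hk : 3 ≤ k) :
    ∑ χ ∈ evenCharacters k, ‖LSeries (fun n : ℕ => χ (n : ZMod k)) 4‖ ^ 2 =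
      Real.pi ^ 8 / (27 * (k : ℝ) ^ 8) * (Nat.totient k : ℝ) *
        (jordanTotient 8 k / 700 + jordanTotient 4 k / 150 + 2 / 21 * jordanTotient 2 k) := by
  classical
  have h1 := sum_norm_sq_dirichletCharacter k fun a => latticeQuartic (a.val / k) / (k : ℝ) ^ 4
  have h2 : ∑ a : ZMod k with IsUnit a, (latticeQuartic (a.val / k) / (k : ℝ) ^ 4) ^ 2
      = (∑ a ∈ range k with a.Coprime k, latticeQuartic (a / k) ^ 2) / (k : ℝ) ^ 8 := by
    rw [sum_div, sum_filter, sum_filter, ← sum_zmod_eq_sum_range k fun a =>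
      if a.Coprime k then latticeQuartic (a / k) ^ 2 / (k : ℝ) ^ 8 else 0]
    refine sum_congr rfl fun a _ => ?_
    have : IsUnit a ↔ a.val.Coprime k := by
      rw [← ZMod.isUnit_iff_coprime, ZMod.natCast_zmod_val]
    simp only [this, div_pow, ← pow_mul]
  simp only [sum_dirichletCharacter_mul_latticeQuartic k (by omega), h2,
    sum_coprime_latticeQuartic_sq k (by omega : 2 ≤ k)]
    at h1
  have h3 : ∑ χ : DirichletCharacter ℂ k,
      ‖(1 + χ (-1)) * LSeries (fun n : ℕ => χ (n : ZMod k)) 4‖ ^ 2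
      = 4 * ∑ χ ∈ evenCharacters k, ‖LSeries (fun n : ℕ => χ (n : ZMod k)) 4‖ ^ 2 := by
    rw [evenCharacters, sum_filter, mul_sum]
    refine sum_congr rfl fun χ _ => ?_
    by_cases hχ : χ.Even
    · have h : χ (-1) = 1 := hχ
      rw [if_pos hχ, h, norm_mul, mul_pow]
      norm_num
    · have h : χ (-1) = -1 := χ.even_or_odd.resolve_left hχ
      rw [if_neg hχ, h]
      simp
  rw [h3] at h1
  linear_combination h1 / 4
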